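/- Let $M\in\mathbb R^{m\times n}$, $\Omega\in\mathbb R^{d\times m}$, $\varepsilon<1$ and $f>0$, and suppose that $\Omega$ is an $\varepsilon$-embedding of $\mathrm{range}(M)$, i.e. $|\langle \Omega x,\Omega y\rangle-\langle x,y\rangle|\le\varepsilon\|x\|_2\|y\|_2$ for all $x,y\in\mathrm{range}(M)$. Let $0\le k\le\mathrm{rank}(M)$. Notation. A $k$-partial QR factorization of a matrix $A$ is $A=QR$ with $Q$ square orthogonal and $R=\begin{pmatrix}R_{11}&R_{12}\\0&R_{22}\end{pmatrix}$, $R_{11}\in\mathbb R^{k\times k}$ upper triangular. Let $\omega_i(R_{11})$ be the Euclidean norm of the $i$-th row of $R_{11}^{-1}$, $\gamma_j(R_{22})$ the Euclidean norm of the $j$-th column of $R_{22}$, and $$\rho(R,k)=\max_{1\le i\le k,\,1\le j\le n-k}\sqrt{(R_{11}^{-1}R_{12})_{ij}^2+\omega_i(R_{11})^2\gamma_j(R_{22})^2},$$ $$\hat\rho(R,k)=\max_{1\le i\le k,\,1\le j\le n-k}\max\{|(R_{11}^{-1}R_{12})_{ij}|,\ \omega_i(R_{11})\gamma_j(R_{22})\},$$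 with $\max\emptyset=0$. Singular values are listed in decreasing order and continued by $0$. The strong RRQR algorithm, applied to a matrix $A$ with $n$ columns, starts from $k=0$, $\Pi=I$. At each stage let $R$ be a $k$-partial R factor of $A\Pi$. As long as $\hat\rho(R,k)>f/\sqrt2$, it interchanges the columns $i$ and $j+k$ of $A\Pi$ for some $i\le k$, $j\le n-k$ with $|(R_{11}^{-1}R_{12})_{ij}|>f/\sqrt2$ or $\omega_i(R_{11})\gamma_j(R_{22})>f/\sqrt2$. Once $\hat\rho(R,k)\le f/\sqrt2$, it returns $(k,\Pi)$ if $k$ equals a given target rank (respectively, if $\max_j\gamma_j(R_{22})<\tau$ for a given tolerance $\tau>0$); otherwise it interchanges the columns $k+1$ and $k+j$, where $j$ maximizes $\gamma_j(R_{22})$, and replaces $k$ by $k+1$. Let $\Pi$ be a permutation matrix such that the algorithm applied to $\Omega M$ can return $(k,\Pi)$, either with target rank $k$ or with some tolerance $\tau>0$; or, more generally, such that $\Omega M\Pi$ has a $k$-partial QR factorization with R factor $R^{sk}$ for which $R^{sk}_{11}$ is invertible and $\rho(R^{sk},k)\le f$. Then for every $k$-partial QR factorization $M\Pi=QR$ (without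 pivoting), with $$\tilde f=\sqrt{\frac{1+\varepsilon}{1-\varepsilon}}\,f,\qquad q=\sqrt{1+\tilde f^2k(n-k)},$$ the block $R_{11}$ is invertible, and for all $1\le i\le k$ and $1\le j\le n-k$: 1. $\sigma_i(R_{11})>0$ and $1\le\dfrac{\sigma_i(M)}{\sigma_i(R_{11})}\le q$; 2. if $\sigma_{j+k}(M)\ne0$, then $1\le\dfrac{\sigma_j(R_{22})}{\sigma_{j+k}(M)}\le q$; if $\sigma_{j+k}(M)=0$, then $\sigma_j(R_{22})=0$; 3. $|(R_{11}^{-1}R_{12})_{ij}|\le\tilde f$. -/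

import Mathlib

noncomputable section

namespace SRRQR

/-- `Ω` is an `ε`-embedding of the subspace `V` (Euclidean inner products and norms). -/
def IsEmbedding {d m : ℕ} (ε : ℝ) (Ω : Matrix (Fin d) (Fin m) ℝ)
    (V : Submodule ℝ (EuclideanSpace ℝ (Fin m))) : Prop :=
  ∀ x ∈ V, ∀ y ∈ V,
    |inner ℝ (Ω.toEuclideanLin x) (Ω.toEuclideanLin y) - inner ℝ x y| ≤ ε * ‖x‖ * ‖y‖

/-- The range of a matrix (the span of its columns). -/
def range {m n : ℕ} (M : Matrix (Fin m) (Fin n) ℝ) : Submodule ℝ (EuclideanSpace ℝ (Fin m)) :=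
  LinearMap.range M.toEuclideanLin

/-- Singular values in decreasing order, indexed from `0`: `sv A i` is `σ_{i+1}(A)`, and it is `0`
for every `i` at or beyond the smaller dimension of `A`. -/
def sv {m n : ℕ} (A : Matrix (Fin m) (Fin n) ℝ) (i : ℕ) : ℝ :=
  A.toEuclideanLin.singularValues i

/-- `M Π`: the `l`-th column of `permCols M π` is the `π l`-th column of `M`, so that
`permCols M (π * Equiv.swap a b)` is `M Π` with its columns `a` and `b` interchanged. -/
def permCols {m n : ℕ} (M : Matrix (Fin m) (Fin n) ℝ) (π : Equiv.Perm (Fin n)) :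
    Matrix (Fin m) (Fin n) ℝ :=
  M.submatrix id π

/-- The index of the `j`-th column (or row) after the first `k` ones. -/
def tailIdx {k n : ℕ} (j : Fin (n - k)) : Fin n := ⟨k + j, by omega⟩

/-- Leading `k × k` block. -/
def R11 {m n : ℕ} (k : ℕ) (hm : k ≤ m) (hn : k ≤ n) (R : Matrix (Fin m) (Fin n) ℝ) :
    Matrix (Fin k) (Fin k) ℝ :=
  R.submatrix (Fin.castLE hm) (Fin.castLE hn)

/-- Upper right `k × (n - k)` block. -/
def R12 {m n : ℕ} (k : ℕ) (hm : k ≤ m) (R : Matrix (Fin m) (Fin n) ℝ) :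
    Matrix (Fin k) (Fin (n - k)) ℝ :=
  R.submatrix (Fin.castLE hm) tailIdx

/-- Lower right `(m - k) × (n - k)` block. -/
def R22 {m n : ℕ} (k : ℕ) (R : Matrix (Fin m) (Fin n) ℝ) :
    Matrix (Fin (m - k)) (Fin (n - k)) ℝ :=
  R.submatrix tailIdx tailIdx

/-- `A = Q R` is a `k`-partial QR factorization (no pivoting): `Q` is orthogonal, the leading
`k × k` block of `R` is upper triangular and the block of `R` below it is zero. -/
structure IsPartialQR {m n : ℕ} (k : ℕ) (A : Matrix (Fin m) (Fin n) ℝ)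
    (Q : Matrix (Fin m) (Fin m) ℝ) (R : Matrix (Fin m) (Fin n) ℝ) : Prop where
  orthogonal : Q ∈ Matrix.orthogonalGroup (Fin m) ℝ
  factor : A = Q * R
  zero_below : ∀ (a : Fin m) (b : Fin n), (b : ℕ) < k → (b : ℕ) < (a : ℕ) → R a b = 0

/-- `ω_i(A)`: Euclidean norm of the `i`-th row of `A⁻¹`. -/
def omega {k : ℕ} (A : Matrix (Fin k) (Fin k) ℝ) (i : Fin k) : ℝ :=
  ‖WithLp.toLp 2 (fun l => A⁻¹ i l)‖

/-- `γ_j(B)`: Euclidean norm of the `j`-th column of `B`. -/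
def gamma {p q : ℕ} (B : Matrix (Fin p) (Fin q) ℝ) (j : Fin q) : ℝ :=
  ‖WithLp.toLp 2 (fun l => B l j)‖

/-- `ρ(R,k)`, the maximum over `i` and `j` of
`√((R₁₁⁻¹R₁₂)_{ij}² + ω_i(R₁₁)² γ_j(R₂₂)²)` (a maximum over the empty set is `0`). -/
def rho {m n : ℕ} (k : ℕ) (hm : k ≤ m) (hn : k ≤ n) (R : Matrix (Fin m) (Fin n) ℝ) : ℝ :=
  ⨆ p : Fin k × Fin (n - k),
    √((((R11 k hm hn R)⁻¹ * R12 k hm R) p.1 p.2) ^ 2 +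
      omega (R11 k hm hn R) p.1 ^ 2 * gamma (R22 k R) p.2 ^ 2)

/-- `ρ̂(R,k)`, the maximum of all `|(R₁₁⁻¹R₁₂)_{ij}|` and all `ω_i(R₁₁) γ_j(R₂₂)`. -/
def rhoHat {m n : ℕ} (k : ℕ) (hm : k ≤ m) (hn : k ≤ n) (R : Matrix (Fin m) (Fin n) ℝ) : ℝ :=
  max (⨆ p : Fin k × Fin (n - k), |((R11 k hm hn R)⁻¹ * R12 k hm R) p.1 p.2|)
    (⨆ p : Fin k × Fin (n - k), omega (R11 k hm hn R) p.1 * gamma (R22 k R) p.2)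

/-- The option with which the strong RRQR algorithm is called: a target rank `r`, or a tolerance
`τ` for the column norms of `R₂₂`. -/
inductive StopRule where
  | targetRank (r : ℕ)
  | tolerance (τ : ℝ)

/-- The condition of the outer loop of the algorithm (`k` is to be increased further), where
`g` is the maximal column norm of the current `R₂₂`. -/
def StopRule.Continue : StopRule → ℕ → ℝ → Prop
  | .targetRank r, k, _ => k < r
  | .tolerance τ, _, g => τ ≤ g

/-- The states (`k`, `Π`) that the strong RRQR algorithm, applied to `A` with parameter `f`, can
reach. The pairs to be interchanged in the inner loop, and the column of maximal norm in case of
ties, are chosen arbitrarily; the current `R` is a `k`-partial `R` factor of `A Π`. -/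
inductive Reach {d n : ℕ} (A : Matrix (Fin d) (Fin n) ℝ) (f : ℝ) (s : StopRule) :
    ℕ → Equiv.Perm (Fin n) → Prop
  | start : Reach A f s 0 1
  /-- Inner loop finished, outer loop continues: `k` is increased, and the column of largest norm
  of `R₂₂` is moved to the new leading position. -/
  | grow {k : ℕ} {π : Equiv.Perm (Fin n)} (hd : k < d) (hn : k < n)
      (Q : Matrix (Fin d) (Fin d) ℝ) (R : Matrix (Fin d) (Fin n) ℝ) (j : Fin (n - k))
      (reached : Reach A f s k π)
      (qr : IsPartialQR k (permCols A π) Q R)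
      (inner_done : rhoHat k hd.le hn.le R ≤ f / √2)
      (continues : s.Continue k (⨆ l, gamma (R22 k R) l))
      (argmax : ∀ l, gamma (R22 k R) l ≤ gamma (R22 k R) j) :
      Reach A f s (k + 1) (π * Equiv.swap ⟨k, hn⟩ (tailIdx j))
  /-- Inner loop: interchange of the columns `i` and `j + k`. -/
  | interchange {k : ℕ} {π : Equiv.Perm (Fin n)} (hd : k ≤ d) (hn : k ≤ n)
      (Q : Matrix (Fin d) (Fin d) ℝ) (R : Matrix (Fin d) (Fin n) ℝ)
      (i : Fin k) (j : Fin (n - k))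
      (reached : Reach A f s k π)
      (qr : IsPartialQR k (permCols A π) Q R)
      (large : f / √2 < |((R11 k hd hn R)⁻¹ * R12 k hd R) i j| ∨
        f / √2 < omega (R11 k hd hn R) i * gamma (R22 k R) j) :
      Reach A f s k (π * Equiv.swap (Fin.castLE hn i) (tailIdx j))

/-- The strong RRQR algorithm, applied to `A` with parameter `f` and option `s`, can stop and
return (`k`, `Π`). -/
def Returns {d n : ℕ} (A : Matrix (Fin d) (Fin n) ℝ) (f : ℝ) (s : StopRule)
    (k : ℕ) (π : Equiv.Perm (Fin n)) : Prop :=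
  Reach A f s k π ∧
    ∃ (hd : k ≤ d) (hn : k ≤ n) (Q : Matrix (Fin d) (Fin d) ℝ) (R : Matrix (Fin d) (Fin n) ℝ),
      IsPartialQR k (permCols A π) Q R ∧ rhoHat k hd hn R ≤ f / √2 ∧
        ¬ s.Continue k (⨆ l, gamma (R22 k R) l)

/-- `Π` is a strong RRQR permutation of `A` for `k` and `f`: it is returned by the algorithm called
with target rank `k`, or, together with `k`, by the algorithm called with a tolerance `τ > 0`; or it
meets the exit criterion shared by all variants of the algorithm, namely that in the factorization
of `A Π` the block `R₁₁` is invertible and `ρ(R,k) ≤ f`. -/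
inductive IsStrongRRQRPerm {d n : ℕ} (A : Matrix (Fin d) (Fin n) ℝ) (f : ℝ) (k : ℕ)
    (π : Equiv.Perm (Fin n)) : Prop
  | ofTargetRank (h : Returns A f (.targetRank k) k π)
  | ofTolerance (τ : ℝ) (hτ : 0 < τ) (h : Returns A f (.tolerance τ) k π)
  | ofCriterion (hd : k ≤ d) (hn : k ≤ n)
      (Q : Matrix (Fin d) (Fin d) ℝ) (R : Matrix (Fin d) (Fin n) ℝ)
      (qr : IsPartialQR k (permCols A π) Q R)
      (det_ne_zero : (R11 k hd hn R).det ≠ 0)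
      (rho_le : rho k hd hn R ≤ f)

end SRRQR

end

noncomputable section

namespace SRRQR

open Module

/-! ### Courant–Fischer principles for singular values. -/

section MinMax

variable {E F : Type*} [NormedAddCommGroup E] [InnerProductSpace ℝ E] [FiniteDimensional ℝ E]
  [NormedAddCommGroup F] [InnerProductSpace ℝ F] [FiniteDimensional ℝ F]

/-! The criterion behind `rho` is metric. Write `N = R₁₁⁻¹R₁₂`. The number `1/ω_i` is the distance
from column `i` to the span of the other leading columns, and `N_ij² + ω_i²γ_j²` is `ω_i²` times the
squared distance from column `k + j` to that same span. It is thus a squared ratio of two distances.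
On the range of `M`, `Ω` changes squared norms by factors in `[1 - ε, 1 + ε]`, so passing from `ΩMΠ`
to `MΠ` costs at most `(1 + ε)/(1 - ε)`, which turns `f` into `f̃` (`IsPartialQR.mul_sq_add_sq_le`).
Bounding one entry of the sum gives the third claim.

The singular value bounds are then deterministic. Summed over `i` and `j`, the same quantity is
`‖N‖_F² + ‖R₁₁⁻¹‖_F² ‖R₂₂‖_F²`, at most `f̃²k(n - k)`. Courant–Fischer, with test subspaces pulled
back through `x ↦ Hx + NUx` or `U` (`H` the head of `x`, `U` its tail), compares the matrix with its
diagonal blocks at the cost `√(1 + s)`, for `s` any bound on that sum (`IsBlockTriangular`).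

For the algorithm itself it remains to see that `R₁₁` is invertible on exit: independence of the
leading columns is an invariant of every step (`Reach.leadIndep`). -/

theorem norm_sq_apply_eq_sum (T : E →ₗ[ℝ] F) (x : E) :
    ‖T x‖ ^ 2 = ∑ i : Fin (finrank ℝ E), T.singularValues i ^ 2 *
      (T.isSymmetric_adjoint_comp_self.eigenvectorBasis rfl).repr x i ^ 2 := by
  set b := T.isSymmetric_adjoint_comp_self.eigenvectorBasis rfl with hb
  have h1 : ‖T x‖ ^ 2 = inner ℝ ((T.adjoint ∘ₗ T) x) x := by
    rw [LinearMap.comp_apply, LinearMap.adjoint_inner_left, real_inner_self_eq_norm_sq]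
  rw [h1, ← b.repr.inner_map_map, PiLp.inner_apply]
  refine Finset.sum_congr rfl fun i _ => ?_
  rw [hb, LinearMap.IsSymmetric.eigenvectorBasis_apply_self_apply, T.sq_singularValues_fin rfl]
  simp
  ring

theorem norm_sq_eq_sum_repr (T : E →ₗ[ℝ] F) (x : E) :
    ‖x‖ ^ 2 = ∑ i : Fin (finrank ℝ E),
      (T.isSymmetric_adjoint_comp_self.eigenvectorBasis rfl).repr x i ^ 2 := by
  rw [← (T.isSymmetric_adjoint_comp_self.eigenvectorBasis rfl).repr.norm_map,
    EuclideanSpace.real_norm_sq_eq]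

/-- The preimage is the kernel of the composite into `W ⧸ S`, so taking preimages does not increase
codimension. All dimension counts for test subspaces rest on this. -/
theorem finrank_add_finrank_le_comap {V W : Type*} [AddCommGroup V] [Module ℝ V]
    [FiniteDimensional ℝ V] [AddCommGroup W] [Module ℝ W] [FiniteDimensional ℝ W]
    (g : V →ₗ[ℝ] W) (S : Submodule ℝ W) :
    finrank ℝ V + finrank ℝ S ≤ finrank ℝ (S.comap g) + finrank ℝ W := by
  have h1 := LinearMap.finrank_range_add_finrank_ker (S.mkQ ∘ₗ g)
  have h2 : LinearMap.ker (S.mkQ ∘ₗ g) = S.comap g := by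
    rw [LinearMap.ker_comp, Submodule.ker_mkQ]
  have h3 := Submodule.finrank_quotient_add_finrank S
  have h4 := Submodule.finrank_le (LinearMap.range (S.mkQ ∘ₗ g))
  rw [h2] at h1
  omega

/-- The vectors whose coordinates satisfying `p` vanish. -/
def coordKer {N : ℕ} (b : OrthonormalBasis (Fin N) ℝ E) (p : Fin N → Prop) : Submodule ℝ E where
  carrier := {x | ∀ i, p i → b.repr x i = 0}
  add_mem' hx hy i hi := by simp [hx i hi, hy i hi]
  zero_mem' i _ := by simp
  smul_mem' c x hx i hi := by simp [hx i hi]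

theorem finrank_le_coordKer {N : ℕ} (b : OrthonormalBasis (Fin N) ℝ E) (p : Fin N → Prop)
    [DecidablePred p] : finrank ℝ E ≤ finrank ℝ (coordKer b p) + Fintype.card {i // p i} := by
  let g : E →ₗ[ℝ] ({i // p i} → ℝ) :=
    { toFun := fun x i => b.repr x i
      map_add' := fun x y => by ext; simp
      map_smul' := fun c x => by ext; simp }
  have h := finrank_add_finrank_le_comap g ⊥
  have h2 : (⊥ : Submodule ℝ ({i // p i} → ℝ)).comap g = coordKer b p := by
    ext x
    simp [coordKer, g, funext_iff]
  rw [h2] at h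
  simpa using h

/-- A subspace of codimension at most `i` on which `T` is bounded by its `i`-th singular value. -/
theorem exists_submodule_norm_le (T : E →ₗ[ℝ] F) (i : ℕ) :
    ∃ S : Submodule ℝ E, finrank ℝ E ≤ finrank ℝ S + i ∧
      ∀ x ∈ S, ‖T x‖ ≤ T.singularValues i * ‖x‖ := by
  set b := T.isSymmetric_adjoint_comp_self.eigenvectorBasis rfl with hb
  -- The orthogonal complement of the first `i` eigenvectors of `T* T`; only singular values of
  -- index at least `i` contribute there.
  refine ⟨coordKer b fun j => (j : ℕ) < i, ?_, fun x hx => ?_⟩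
  · refine (finrank_le_coordKer b fun j => (j : ℕ) < i).trans ?_
    gcongr
    have := Fintype.card_le_of_injective
      (fun j : {j : Fin (finrank ℝ E) // (j : ℕ) < i} => (⟨j.1, j.2⟩ : Fin i))
      (fun a c h => by simpa [Subtype.ext_iff, Fin.ext_iff] using h)
    simpa using this
  · refine le_of_sq_le_sq ?_ (mul_nonneg (T.singularValues_nonneg i) (norm_nonneg x))
    rw [mul_pow, norm_sq_apply_eq_sum, norm_sq_eq_sum_repr T, Finset.mul_sum]
    refine Finset.sum_le_sum fun j _ => ?_
    by_cases hj : (j : ℕ) < i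
    · have := hx j hj
      rw [← hb, this]; simp
    · have h1 := T.singularValues_antitone (not_lt.1 hj)
      have h2 := T.singularValues_nonneg j
      gcongr

/-- A subspace of dimension at least `i + 1` on which `T` is bounded below by its `i`-th singular
value. -/
theorem exists_submodule_le_norm (T : E →ₗ[ℝ] F) {i : ℕ} (hi : i < finrank ℝ E) :
    ∃ S : Submodule ℝ E, i + 1 ≤ finrank ℝ S ∧
      ∀ x ∈ S, T.singularValues i * ‖x‖ ≤ ‖T x‖ := by
  set b := T.isSymmetric_adjoint_comp_self.eigenvectorBasis rfl with hb
  refine ⟨coordKer b fun j => i < (j : ℕ), ?_, fun x hx => ?_⟩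
  · have h := finrank_le_coordKer b fun j => i < (j : ℕ)
    have := Fintype.card_le_of_injective
      (fun j : {j : Fin (finrank ℝ E) // i < (j : ℕ)} =>
        (⟨j.1 - (i + 1), by have := j.1.2; have := j.2; omega⟩ : Fin (finrank ℝ E - (i + 1))))
      (fun a c h => by
        have := a.2; have := c.2
        simp [Subtype.ext_iff, Fin.ext_iff] at h ⊢
        omega)
    rw [Fintype.card_fin] at this
    omega
  · refine le_of_sq_le_sq ?_ (norm_nonneg _)
    rw [mul_pow, norm_sq_apply_eq_sum, norm_sq_eq_sum_repr T, Finset.mul_sum]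
    refine Finset.sum_le_sum fun j _ => ?_
    by_cases hj : i < (j : ℕ)
    · have := hx j hj
      rw [← hb, this]; simp
    · have h1 := T.singularValues_antitone (not_lt.1 hj)
      have h2 := T.singularValues_nonneg i
      gcongr

theorem exists_ne_zero_mem_mem (S U : Submodule ℝ E) (h : finrank ℝ E < finrank ℝ S + finrank ℝ U) :
    ∃ x ∈ S, x ∈ U ∧ x ≠ 0 := by
  have h1 := Submodule.finrank_sup_add_finrank_inf_eq S U
  have h2 := Submodule.finrank_le (S ⊔ U)
  have h3 : S ⊓ U ≠ ⊥ := fun h0 => by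
    rw [h0, finrank_bot] at h1
    omega
  obtain ⟨x, hx, hx0⟩ := Submodule.exists_mem_ne_zero_of_ne_bot h3
  exact ⟨x, hx.1, hx.2, hx0⟩

theorem singularValues_le_of_submodule (T : E →ₗ[ℝ] F) {i : ℕ} {c : ℝ} (hc : 0 ≤ c)
    (S : Submodule ℝ E) (hS : finrank ℝ E ≤ finrank ℝ S + i) (h : ∀ x ∈ S, ‖T x‖ ≤ c * ‖x‖) :
    T.singularValues i ≤ c := by
  by_cases hi : i < finrank ℝ E
  · obtain ⟨U, hU, hT⟩ := exists_submodule_le_norm T hi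
    obtain ⟨x, hxS, hxU, hx⟩ := exists_ne_zero_mem_mem S U (by omega)
    exact le_of_mul_le_mul_right ((hT x hxU).trans (h x hxS)) (norm_pos_iff.2 hx)
  · rwa [T.singularValues_of_finrank_le (not_lt.1 hi)]

theorem le_singularValues_of_submodule (T : E →ₗ[ℝ] F) {i : ℕ} {c : ℝ}
    (S : Submodule ℝ E) (hS : i + 1 ≤ finrank ℝ S) (h : ∀ x ∈ S, c * ‖x‖ ≤ ‖T x‖) :
    c ≤ T.singularValues i := by
  obtain ⟨U, hU, hT⟩ := exists_submodule_norm_le T i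
  obtain ⟨x, hxS, hxU, hx⟩ := exists_ne_zero_mem_mem S U (by omega)
  exact le_of_mul_le_mul_right ((h x hxS).trans (hT x hxU)) (norm_pos_iff.2 hx)

/-- `T'` is `T` restricted along an isometry, so a test subspace for `T` pulls back to one for `T'`
of no larger codimension. -/
theorem singularValues_le_of_comap {E' F' : Type*} [NormedAddCommGroup E'] [InnerProductSpace ℝ E']
    [FiniteDimensional ℝ E'] [NormedAddCommGroup F'] [InnerProductSpace ℝ F']
    [FiniteDimensional ℝ F'] (T : E →ₗ[ℝ] F) (T' : E' →ₗ[ℝ] F') (g : E' →ₗ[ℝ] E)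
    (hg : ∀ x, ‖g x‖ = ‖x‖) (hT : ∀ x, ‖T' x‖ = ‖T (g x)‖) (i : ℕ) :
    T'.singularValues i ≤ T.singularValues i := by
  obtain ⟨S, hS, h⟩ := exists_submodule_norm_le T i
  refine singularValues_le_of_submodule T' (T.singularValues_nonneg i) (S.comap g) ?_ ?_
  · have := finrank_add_finrank_le_comap g S
    omega
  · intro x hx
    rw [hT, ← hg x]
    exact h _ hx

end MinMax

/-! ### Gu–Eisenstat inequalities for block triangular maps. -/

section GuEisenstat

set_option linter.unusedSectionVars false

variable {E F E₁ F₁ E₂ F₂ : Type*} [NormedAddCommGroup E] [InnerProductSpace ℝ E]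
  [FiniteDimensional ℝ E] [NormedAddCommGroup F] [InnerProductSpace ℝ F] [FiniteDimensional ℝ F]
  [NormedAddCommGroup E₁] [InnerProductSpace ℝ E₁] [FiniteDimensional ℝ E₁]
  [NormedAddCommGroup F₁] [InnerProductSpace ℝ F₁] [FiniteDimensional ℝ F₁]
  [NormedAddCommGroup E₂] [InnerProductSpace ℝ E₂] [FiniteDimensional ℝ E₂]
  [NormedAddCommGroup F₂] [InnerProductSpace ℝ F₂] [FiniteDimensional ℝ F₂]

/-- `T` is, up to isometries, the block upper triangular map `(A, A N; 0, B)`; `H` and `U` are the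
coordinate projections of its domain. -/
structure IsBlockTriangular (T : E →ₗ[ℝ] F) (H : E →ₗ[ℝ] E₁) (U : E →ₗ[ℝ] E₂) (A : E₁ →ₗ[ℝ] F₁)
    (N : E₂ →ₗ[ℝ] E₁) (B : E₂ →ₗ[ℝ] F₂) : Prop where
  finrank_eq : finrank ℝ E = finrank ℝ E₁ + finrank ℝ E₂
  norm_sq : ∀ x, ‖x‖ ^ 2 = ‖H x‖ ^ 2 + ‖U x‖ ^ 2
  norm_sq_apply : ∀ x, ‖T x‖ ^ 2 = ‖A (H x + N (U x))‖ ^ 2 + ‖B (U x)‖ ^ 2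

variable {T : E →ₗ[ℝ] F} {H : E →ₗ[ℝ] E₁} {U : E →ₗ[ℝ] E₂} {A : E₁ →ₗ[ℝ] F₁}
  {N : E₂ →ₗ[ℝ] E₁} {B : E₂ →ₗ[ℝ] F₂}

theorem add_mul_sq_le (a b ν : ℝ) : (a + ν * b) ^ 2 ≤ (1 + ν ^ 2) * (a ^ 2 + b ^ 2) := by
  nlinarith [sq_nonneg (ν * a - b)]

/-- On the preimage under `H + N U` of a test subspace for `A`, the first block contributes at most
`σ²(1 + ν²)‖x‖²`. The second contributes at most `β²‖x‖²`, which `1 ≤ wσ` absorbs into `σ²w²β²‖x‖²`.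
-/
theorem IsBlockTriangular.singularValues_le_mul (h : IsBlockTriangular T H U A N B)
    {w ν β s : ℝ} (hA : ∀ x, ‖x‖ ≤ w * ‖A x‖) (hN : ∀ x, ‖N x‖ ≤ ν * ‖x‖)
    (hB : ∀ x, ‖B x‖ ≤ β * ‖x‖) (hs : ν ^ 2 + w ^ 2 * β ^ 2 ≤ s) {i : ℕ}
    (hi : i < finrank ℝ E₁) :
    T.singularValues i ≤ √(1 + s) * A.singularValues i := by
  obtain ⟨S, hS, hAS⟩ := exists_submodule_norm_le A i
  have hσ := A.singularValues_nonneg i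
  set σ := A.singularValues i
  have hs0 : 0 ≤ 1 + s := by nlinarith [sq_nonneg ν, sq_nonneg (w * β)]
  -- As `i < finrank E₁`, `S` is nonzero; one nonzero vector of it yields both `0 ≤ w` and `1 ≤ wσ`.
  obtain ⟨z, hzS, -, hz⟩ := exists_ne_zero_mem_mem S ⊤ (by rw [finrank_top]; omega)
  have hz' := norm_pos_iff.2 hz
  have hw0 : 0 ≤ w := by
    by_contra hw
    nlinarith [hA z, norm_nonneg (A z)]
  have hw : 1 ≤ w * σ := by
    refine le_of_mul_le_mul_right ?_ hz'
    have := mul_le_mul_of_nonneg_left (hAS z hzS) hw0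
    nlinarith [hA z]
  refine singularValues_le_of_submodule T (by positivity) (S.comap (H + N ∘ₗ U)) ?_ ?_
  · have := finrank_add_finrank_le_comap (H + N ∘ₗ U) S
    omega
  · intro x hx
    refine le_of_sq_le_sq ?_ (by positivity)
    rw [mul_pow, mul_pow, Real.sq_sqrt hs0, h.norm_sq_apply, h.norm_sq]
    have h1 : ‖A (H x + N (U x))‖ ^ 2 ≤ σ ^ 2 * ‖H x + N (U x)‖ ^ 2 := by
      rw [← mul_pow]
      exact pow_le_pow_left₀ (norm_nonneg _) (hAS _ (by simpa using hx)) 2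
    have h2 : ‖B (U x)‖ ^ 2 ≤ β ^ 2 * ‖U x‖ ^ 2 := by
      rw [← mul_pow]
      exact pow_le_pow_left₀ (norm_nonneg _) (hB _) 2
    have h3 : ‖H x + N (U x)‖ ^ 2 ≤ (1 + ν ^ 2) * (‖H x‖ ^ 2 + ‖U x‖ ^ 2) :=
      (pow_le_pow_left₀ (norm_nonneg _)
        ((norm_add_le _ _).trans (add_le_add_right (hN _) _)) 2).trans (add_mul_sq_le _ _ _)
    have h4 : β ^ 2 * ‖U x‖ ^ 2 ≤ σ ^ 2 * (w ^ 2 * β ^ 2 * (‖H x‖ ^ 2 + ‖U x‖ ^ 2)) := by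
      have e1 : (1 : ℝ) ≤ (w * σ) ^ 2 := one_le_pow₀ hw
      have e2 : β ^ 2 * ‖U x‖ ^ 2 ≤ β ^ 2 * (‖H x‖ ^ 2 + ‖U x‖ ^ 2) := by
        gcongr; nlinarith [sq_nonneg ‖H x‖]
      have e3 := mul_le_mul_of_nonneg_right e1
        (by positivity : 0 ≤ β ^ 2 * (‖H x‖ ^ 2 + ‖U x‖ ^ 2))
      nlinarith
    have h5 := mul_le_mul_of_nonneg_left h3 (sq_nonneg σ)
    have h6 : (1 + ν ^ 2 + w ^ 2 * β ^ 2) * (σ ^ 2 * (‖H x‖ ^ 2 + ‖U x‖ ^ 2)) ≤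
        (1 + s) * (σ ^ 2 * (‖H x‖ ^ 2 + ‖U x‖ ^ 2)) := by
      gcongr ?_ * _
      linarith
    nlinarith

/-- Where `Hx + N(Ux) = 0`, `T` acts as `B` on `Ux`. This condition costs `finrank E₁` dimensions,
hence the index shift. -/
theorem IsBlockTriangular.singularValues_add_le (h : IsBlockTriangular T H U A N B) (j : ℕ) :
    T.singularValues (j + finrank ℝ E₁) ≤ B.singularValues j := by
  obtain ⟨S, hS, hBS⟩ := exists_submodule_norm_le B j
  have hσ := B.singularValues_nonneg j
  refine singularValues_le_of_submodule T hσ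
    ((⊥ : Submodule ℝ E₁).comap (H + N ∘ₗ U) ⊓ S.comap U) ?_ ?_
  · have h1 := finrank_add_finrank_le_comap (H + N ∘ₗ U) ⊥
    have h2 := finrank_add_finrank_le_comap U S
    have h3 := Submodule.finrank_sup_add_finrank_inf_eq
      ((⊥ : Submodule ℝ E₁).comap (H + N ∘ₗ U)) (S.comap U)
    have h4 := Submodule.finrank_le ((⊥ : Submodule ℝ E₁).comap (H + N ∘ₗ U) ⊔ S.comap U)
    rw [finrank_bot] at h1
    omega
  · rintro x ⟨hx1, hx2⟩
    have hx1' : H x + N (U x) = 0 := by simpa using hx1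
    refine le_of_sq_le_sq ?_ (by positivity)
    rw [h.norm_sq_apply, hx1', map_zero, norm_zero]
    have h1 : ‖B (U x)‖ ^ 2 ≤ (B.singularValues j * ‖U x‖) ^ 2 :=
      pow_le_pow_left₀ (norm_nonneg _) (hBS _ hx2) 2
    rw [mul_pow] at h1 ⊢
    rw [h.norm_sq x]
    nlinarith [mul_nonneg (sq_nonneg (B.singularValues j)) (sq_nonneg ‖H x‖)]

/-- For `Ux` in a subspace where `B` is bounded below by `σ`, the tail of `x` is controlled by
`B(Ux)`. The head is controlled through `A⁻¹` and `N`, using `σ ≤ β`, and Cauchy–Schwarz combines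
the two. -/
theorem IsBlockTriangular.singularValues_le_mul_add (h : IsBlockTriangular T H U A N B)
    {w ν β s : ℝ} (hA : ∀ x, ‖x‖ ≤ w * ‖A x‖) (hN : ∀ x, ‖N x‖ ≤ ν * ‖x‖) (hβ : 0 ≤ β)
    (hB : ∀ x, ‖B x‖ ≤ β * ‖x‖) (hs : ν ^ 2 + w ^ 2 * β ^ 2 ≤ s) {j : ℕ}
    (hj : j < finrank ℝ E₂) :
    B.singularValues j ≤ √(1 + s) * T.singularValues (j + finrank ℝ E₁) := by
  obtain ⟨S, hS, hBS⟩ := exists_submodule_le_norm B hj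
  have hσ := B.singularValues_nonneg j
  have hσβ : B.singularValues j ≤ β :=
    singularValues_le_of_submodule B hβ ⊤ (by rw [finrank_top]; omega) fun x _ => hB x
  set σ := B.singularValues j
  have hs0 : 0 < 1 + s := by nlinarith [sq_nonneg ν, sq_nonneg (w * β)]
  have hq : 0 < √(1 + s) := Real.sqrt_pos.2 hs0
  rw [← div_le_iff₀' hq]
  refine le_singularValues_of_submodule T (S.comap U) ?_ ?_
  · have := finrank_add_finrank_le_comap U S
    have := h.finrank_eq
    omega
  · intro x hx
    rw [div_mul_eq_mul_div, div_le_iff₀' hq]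
    refine le_of_sq_le_sq ?_ (by positivity)
    rw [mul_pow, mul_pow, Real.sq_sqrt hs0.le, h.norm_sq_apply, h.norm_sq]
    set u := ‖A (H x + N (U x))‖
    set v := ‖B (U x)‖
    have hv : σ * ‖U x‖ ≤ v := hBS _ hx
    have hv' : (σ * ‖U x‖) ^ 2 ≤ v ^ 2 := pow_le_pow_left₀ (by positivity) hv 2
    have h1 : σ * ‖H x + N (U x)‖ ≤ w * β * u := by
      calc σ * ‖H x + N (U x)‖ ≤ β * ‖H x + N (U x)‖ := by gcongr
        _ ≤ β * (w * u) := by gcongr; exact hA _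
        _ = w * β * u := by ring
    have h2 : ‖H x‖ ≤ ‖H x + N (U x)‖ + ν * ‖U x‖ := by
      have := norm_sub_le (H x + N (U x)) (N (U x))
      rw [add_sub_cancel_right] at this
      linarith [hN (U x)]
    have h3 : σ * ‖H x‖ ≤ w * β * u + ν * (σ * ‖U x‖) := by
      nlinarith [mul_le_mul_of_nonneg_left h2 hσ]
    have h4 : (σ * ‖H x‖) ^ 2 ≤ (w * β * u + ν * (σ * ‖U x‖)) ^ 2 :=
      pow_le_pow_left₀ (by positivity) h3 2
    have h5 : (w * β * u + ν * (σ * ‖U x‖)) ^ 2 ≤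
        (w ^ 2 * β ^ 2 + ν ^ 2) * (u ^ 2 + (σ * ‖U x‖) ^ 2) := by
      nlinarith [sq_nonneg (w * β * (σ * ‖U x‖) - ν * u)]
    have hs' : 0 ≤ s := by nlinarith [sq_nonneg ν, sq_nonneg (w * β)]
    have h6 : (w ^ 2 * β ^ 2 + ν ^ 2) * (u ^ 2 + (σ * ‖U x‖) ^ 2) ≤ s * (u ^ 2 + v ^ 2) := by
      gcongr
      linarith
    nlinarith [sq_nonneg u]

end GuEisenstat

/-! ### Block coordinates, QR factors, and the norms `omega` and `gamma`. -/

section Blocks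

variable {m n k : ℕ}

/-- The partition of the indices into the first `k` ones and the others. -/
def splitEquiv (hn : k ≤ n) : Fin k ⊕ Fin (n - k) ≃ Fin n :=
  finSumFinEquiv.trans (finCongr (Nat.add_sub_cancel' hn))

@[simp]
theorem splitEquiv_inl (hn : k ≤ n) (i : Fin k) : splitEquiv hn (.inl i) = Fin.castLE hn i := by
  ext; simp [splitEquiv]

@[simp]
theorem splitEquiv_inr (hn : k ≤ n) (j : Fin (n - k)) : splitEquiv hn (.inr j) = tailIdx j := by
  ext; simp [splitEquiv, tailIdx]

theorem sum_split (hn : k ≤ n) (g : Fin n → ℝ) :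
    ∑ b, g b = ∑ i, g (Fin.castLE hn i) + ∑ j : Fin (n - k), g (tailIdx j) := by
  rw [← (splitEquiv hn).sum_comp, Fintype.sum_sum_type]
  simp

/-- The first `k` coordinates. -/
def headLin (hn : k ≤ n) : EuclideanSpace ℝ (Fin n) →ₗ[ℝ] EuclideanSpace ℝ (Fin k) where
  toFun x := WithLp.toLp 2 fun i => x (Fin.castLE hn i)
  map_add' x y := by ext; simp
  map_smul' c x := by ext; simp

/-- The coordinates after the first `k` ones. -/
def tailLin (k : ℕ) : EuclideanSpace ℝ (Fin n) →ₗ[ℝ] EuclideanSpace ℝ (Fin (n - k)) where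
  toFun x := WithLp.toLp 2 fun j => x (tailIdx j)
  map_add' x y := by ext; simp
  map_smul' c x := by ext; simp

@[simp]
theorem headLin_apply (hn : k ≤ n) (x : EuclideanSpace ℝ (Fin n)) (i : Fin k) :
    headLin hn x i = x (Fin.castLE hn i) := rfl

@[simp]
theorem tailLin_apply (x : EuclideanSpace ℝ (Fin n)) (j : Fin (n - k)) :
    tailLin k x j = x (tailIdx j) := rfl

/-- The vector with given head and tail. -/
def glue (hn : k ≤ n) (x : EuclideanSpace ℝ (Fin k)) (y : EuclideanSpace ℝ (Fin (n - k))) :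
    EuclideanSpace ℝ (Fin n) :=
  WithLp.toLp 2 fun b => Sum.elim (fun i => x i) (fun j => y j) ((splitEquiv hn).symm b)

@[simp]
theorem headLin_glue (hn : k ≤ n) (x : EuclideanSpace ℝ (Fin k))
    (y : EuclideanSpace ℝ (Fin (n - k))) : headLin hn (glue hn x y) = x := by
  ext i
  rw [headLin_apply, ← splitEquiv_inl]
  simp only [glue, Equiv.symm_apply_apply, Sum.elim_inl]

@[simp]
theorem tailLin_glue (hn : k ≤ n) (x : EuclideanSpace ℝ (Fin k))
    (y : EuclideanSpace ℝ (Fin (n - k))) : tailLin k (glue hn x y) = y := by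
  ext j
  rw [tailLin_apply, ← splitEquiv_inr hn]
  simp only [glue, Equiv.symm_apply_apply, Sum.elim_inr]

theorem eq_of_headLin_of_tailLin (hn : k ≤ n) {x y : EuclideanSpace ℝ (Fin n)}
    (h1 : headLin hn x = headLin hn y) (h2 : tailLin k x = tailLin k y) : x = y := by
  ext b
  obtain ⟨i | j, rfl⟩ := (splitEquiv hn).surjective b
  · rw [splitEquiv_inl, ← headLin_apply, ← headLin_apply, h1]
  · rw [splitEquiv_inr, ← tailLin_apply, ← tailLin_apply, h2]

theorem norm_sq_split (hn : k ≤ n) (x : EuclideanSpace ℝ (Fin n)) :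
    ‖x‖ ^ 2 = ‖headLin hn x‖ ^ 2 + ‖tailLin k x‖ ^ 2 := by
  simp only [EuclideanSpace.real_norm_sq_eq]
  exact sum_split hn fun b => x b ^ 2

theorem IsPartialQR.norm_apply {A R : Matrix (Fin m) (Fin n) ℝ} {Q : Matrix (Fin m) (Fin m) ℝ}
    (h : IsPartialQR k A Q R) (x : EuclideanSpace ℝ (Fin n)) :
    ‖A.toEuclideanLin x‖ = ‖R.toEuclideanLin x‖ := by
  have hQ : Q.transpose * Q = 1 := by
    simpa [Matrix.star_eq_conjTranspose] using (Matrix.mem_orthogonalGroup_iff' (Fin m) ℝ).1 h.orthogonal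
  have key : ∀ v : Fin m → ℝ, (Q.mulVec v) ⬝ᵥ (Q.mulVec v) = v ⬝ᵥ v := fun v => by
    rw [Matrix.dotProduct_mulVec, Matrix.vecMul_mulVec, hQ, Matrix.vecMul_one]
  have e : ‖A.toEuclideanLin x‖ ^ 2 = ‖R.toEuclideanLin x‖ ^ 2 := by
    simp only [EuclideanSpace.real_norm_sq_eq, Matrix.toLpLin_apply]
    rw [h.factor, ← Matrix.mulVec_mulVec]
    simpa [dotProduct, sq] using key (R.mulVec x)
  exact (sq_eq_sq₀ (norm_nonneg _) (norm_nonneg _)).1 e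

theorem IsPartialQR.norm_sq_apply {A R : Matrix (Fin m) (Fin n) ℝ} {Q : Matrix (Fin m) (Fin m) ℝ}
    (h : IsPartialQR k A Q R) (hm : k ≤ m) (hn : k ≤ n) (x : EuclideanSpace ℝ (Fin n)) :
    ‖A.toEuclideanLin x‖ ^ 2 =
      ‖(R11 k hm hn R).toEuclideanLin (headLin hn x) +
        (R12 k hm R).toEuclideanLin (tailLin k x)‖ ^ 2 +
      ‖(R22 k R).toEuclideanLin (tailLin k x)‖ ^ 2 := by
  rw [h.norm_apply, norm_sq_split hm]
  congr 3
  · ext a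
    simp only [headLin_apply, PiLp.add_apply, Matrix.ofLp_toLpLin, Matrix.toLin'_apply, Matrix.mulVec,
      dotProduct]
    rw [sum_split hn]
    rfl
  · ext a
    simp only [tailLin_apply, Matrix.ofLp_toLpLin, Matrix.toLin'_apply, Matrix.mulVec, dotProduct]
    rw [sum_split hn, Finset.sum_eq_zero, zero_add]
    · rfl
    · intro i _
      rw [h.zero_below, zero_mul]
      · simp
      · simp [tailIdx]; omega

theorem toEuclideanLin_mul_apply {p q r : ℕ} (A : Matrix (Fin p) (Fin q) ℝ)
    (B : Matrix (Fin q) (Fin r) ℝ) (x : EuclideanSpace ℝ (Fin r)) :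
    (A * B).toEuclideanLin x = A.toEuclideanLin (B.toEuclideanLin x) := by
  simp [Matrix.toLpLin_apply]

theorem toEuclideanLin_inv_apply {A : Matrix (Fin k) (Fin k) ℝ} (hA : A.det ≠ 0)
    (x : EuclideanSpace ℝ (Fin k)) : A⁻¹.toEuclideanLin (A.toEuclideanLin x) = x := by
  rw [← toEuclideanLin_mul_apply, Matrix.nonsing_inv_mul _ (isUnit_iff_ne_zero.2 hA)]
  simp

theorem toEuclideanLin_apply_inv {A : Matrix (Fin k) (Fin k) ℝ} (hA : A.det ≠ 0)
    (x : EuclideanSpace ℝ (Fin k)) : A.toEuclideanLin (A⁻¹.toEuclideanLin x) = x := by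
  rw [← toEuclideanLin_mul_apply, Matrix.mul_nonsing_inv _ (isUnit_iff_ne_zero.2 hA)]
  simp

theorem IsPartialQR.isBlockTriangular {A R : Matrix (Fin m) (Fin n) ℝ}
    {Q : Matrix (Fin m) (Fin m) ℝ} (h : IsPartialQR k A Q R) (hm : k ≤ m) (hn : k ≤ n)
    (hdet : (R11 k hm hn R).det ≠ 0) :
    IsBlockTriangular A.toEuclideanLin (headLin hn) (tailLin k) (R11 k hm hn R).toEuclideanLin
      ((R11 k hm hn R)⁻¹ * R12 k hm R).toEuclideanLin (R22 k R).toEuclideanLin where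
  finrank_eq := by simp; omega
  norm_sq := norm_sq_split hn
  norm_sq_apply x := by
    rw [h.norm_sq_apply hm hn, map_add, toEuclideanLin_mul_apply, toEuclideanLin_apply_inv hdet]

theorem norm_toEuclideanLin_single {p q : ℕ} (B : Matrix (Fin p) (Fin q) ℝ) (j : Fin q) (t : ℝ) :
    ‖B.toEuclideanLin (EuclideanSpace.single j t)‖ = |t| * gamma B j := by
  have : B.toEuclideanLin (EuclideanSpace.single j t) = t • WithLp.toLp 2 fun l => B l j := by
    ext l
    simp [Matrix.toLpLin_apply]
  rw [this, norm_smul, Real.norm_eq_abs, gamma]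

theorem norm_toEuclideanLin_le {p q : ℕ} (B : Matrix (Fin p) (Fin q) ℝ)
    (x : EuclideanSpace ℝ (Fin q)) :
    ‖B.toEuclideanLin x‖ ≤ √(∑ i, ∑ j, B i j ^ 2) * ‖x‖ := by
  refine le_of_sq_le_sq ?_ (by positivity)
  rw [mul_pow, Real.sq_sqrt (by positivity), EuclideanSpace.real_norm_sq_eq,
    EuclideanSpace.real_norm_sq_eq, Finset.sum_mul]
  refine Finset.sum_le_sum fun i _ => ?_
  exact Finset.sum_mul_sq_le_sq_mul_sq Finset.univ (fun j => B i j) fun j => x j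

theorem sum_gamma_sq {p q : ℕ} (B : Matrix (Fin p) (Fin q) ℝ) :
    ∑ j, gamma B j ^ 2 = ∑ i, ∑ j, B i j ^ 2 := by
  simp only [gamma, EuclideanSpace.real_norm_sq_eq]
  exact Finset.sum_comm

theorem sum_omega_sq (A : Matrix (Fin k) (Fin k) ℝ) :
    ∑ i, omega A i ^ 2 = ∑ i, ∑ j, A⁻¹ i j ^ 2 := by
  simp only [omega, EuclideanSpace.real_norm_sq_eq]

/-- `y i` is the inner product of row `i` of `A⁻¹` with `A y`. Together with the equality case
`exists_omega_mul_norm_eq`, this makes `1/ω_i` the minimum of `‖A y‖` over `y i = 1`. -/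
theorem abs_apply_le_omega {A : Matrix (Fin k) (Fin k) ℝ} (hA : A.det ≠ 0)
    (y : EuclideanSpace ℝ (Fin k)) (i : Fin k) : |y i| ≤ omega A i * ‖A.toEuclideanLin y‖ := by
  have h : ∀ z : EuclideanSpace ℝ (Fin k),
      A⁻¹.toEuclideanLin z i = inner ℝ (WithLp.toLp 2 (fun l => A⁻¹ i l)) z := fun z => by
    simp [Matrix.toLpLin_apply, Matrix.mulVec, dotProduct, PiLp.inner_apply, mul_comm]
  conv_lhs => rw [← toEuclideanLin_inv_apply hA y, h]
  exact abs_real_inner_le_norm _ _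

theorem omega_pos {A : Matrix (Fin k) (Fin k) ℝ} (hA : A.det ≠ 0) (i : Fin k) :
    0 < omega A i := by
  have h := abs_apply_le_omega hA (EuclideanSpace.single i 1) i
  refine (norm_nonneg _).lt_of_ne fun h0 => ?_
  rw [omega, ← h0] at h
  simp at h
  linarith

theorem exists_omega_mul_norm_eq {A : Matrix (Fin k) (Fin k) ℝ} (hA : A.det ≠ 0) (i : Fin k) :
    ∃ y : EuclideanSpace ℝ (Fin k), y i = 1 ∧ omega A i * ‖A.toEuclideanLin y‖ = 1 := by
  have hω := omega_pos hA i
  set r : EuclideanSpace ℝ (Fin k) := WithLp.toLp 2 (fun l => A⁻¹ i l) with hr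
  have hr' : ‖r‖ = omega A i := rfl
  -- Equality in Cauchy–Schwarz: `A y` is taken parallel to row `i` of `A⁻¹`.
  refine ⟨A⁻¹.toEuclideanLin ((omega A i ^ 2)⁻¹ • r), ?_, ?_⟩
  · have : (A⁻¹.toEuclideanLin r) i = omega A i ^ 2 := by
      rw [← hr', EuclideanSpace.real_norm_sq_eq]
      simp [Matrix.mulVec, dotProduct, hr, sq]
    rw [map_smul, PiLp.smul_apply, this, smul_eq_mul, inv_mul_cancel₀ (by positivity)]
  · rw [toEuclideanLin_apply_inv hA, norm_smul, hr']
    rw [norm_inv, norm_pow, Real.norm_of_nonneg hω.le]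
    field_simp

end Blocks

/-! ### Invariance of independence under the algorithm; distortion of the exit criterion. -/

section Exchange

variable {m n d k : ℕ}

/-- The first `k` columns of `A` are linearly independent. -/
def LeadIndep (A : Matrix (Fin m) (Fin n) ℝ) (k : ℕ) : Prop :=
  ∀ x : EuclideanSpace ℝ (Fin n), (∀ b : Fin n, k ≤ b → x b = 0) → A.toEuclideanLin x = 0 → x = 0

theorem tailLin_eq_zero {x : EuclideanSpace ℝ (Fin n)} :
    tailLin k x = 0 ↔ ∀ b : Fin n, k ≤ b → x b = 0 := by
  constructor
  · intro h b hb
    have h1 := congrArg (fun y => y (⟨b - k, by omega⟩ : Fin (n - k))) h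
    have h2 : tailIdx (⟨b - k, by omega⟩ : Fin (n - k)) = b := by
      ext; simp [tailIdx]; omega
    simpa [h2] using h1
  · intro h
    ext j
    exact h _ (by simp [tailIdx])

theorem IsPartialQR.det_ne_zero {A R : Matrix (Fin m) (Fin n) ℝ} {Q : Matrix (Fin m) (Fin m) ℝ}
    (h : IsPartialQR k A Q R) (hm : k ≤ m) (hn : k ≤ n) (hA : LeadIndep A k) :
    (R11 k hm hn R).det ≠ 0 := by
  intro h0
  obtain ⟨v, hv, hv0⟩ := Matrix.exists_mulVec_eq_zero_iff.2 h0
  have h1 := hA (glue hn (WithLp.toLp 2 v) 0) (tailLin_eq_zero.1 (tailLin_glue _ _ _)) (by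
    rw [← norm_eq_zero, ← sq_eq_zero_iff, h.norm_sq_apply hm hn, headLin_glue, tailLin_glue]
    simp [Matrix.toLpLin_apply, hv0])
  have h2 := congrArg (headLin hn) h1
  rw [headLin_glue, map_zero] at h2
  exact hv (by simpa using h2)

theorem IsPartialQR.leadIndep {A R : Matrix (Fin m) (Fin n) ℝ} {Q : Matrix (Fin m) (Fin m) ℝ}
    (h : IsPartialQR k A Q R) (hm : k ≤ m) (hn : k ≤ n) (hdet : (R11 k hm hn R).det ≠ 0) :
    LeadIndep A k := by
  intro x hx hAx
  have ht := tailLin_eq_zero.2 hx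
  have h1 := h.norm_sq_apply hm hn x
  rw [hAx, ht] at h1
  have h2 : (R11 k hm hn R).toEuclideanLin (headLin hn x) = 0 := by simpa using h1.symm
  have h3 := toEuclideanLin_inv_apply hdet (headLin hn x)
  rw [h2, map_zero] at h3
  exact eq_of_headLin_of_tailLin hn (by rw [← h3, map_zero]) (by rw [ht, map_zero])

/-- The action of a permutation on coordinates. -/
def permVec (π : Equiv.Perm (Fin n)) : EuclideanSpace ℝ (Fin n) ≃ₗᵢ[ℝ] EuclideanSpace ℝ (Fin n) :=
  LinearIsometryEquiv.piLpCongrLeft 2 ℝ ℝ π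

@[simp]
theorem permVec_apply (π : Equiv.Perm (Fin n)) (x : EuclideanSpace ℝ (Fin n)) (b : Fin n) :
    permVec π x b = x (π.symm b) := by
  simp [permVec, LinearIsometryEquiv.piLpCongrLeft_apply, Equiv.piCongrLeft']

theorem permCols_apply (A : Matrix (Fin m) (Fin n) ℝ) (π : Equiv.Perm (Fin n))
    (x : EuclideanSpace ℝ (Fin n)) :
    (permCols A π).toEuclideanLin x = A.toEuclideanLin (permVec π x) := by
  ext a
  simp only [Matrix.ofLp_toLpLin, Matrix.toLin'_apply, Matrix.mulVec, dotProduct, permVec_apply]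
  rw [← Equiv.sum_comp π fun b => A a b * x (π.symm b)]
  simp [permCols]

theorem singularValues_permCols (A : Matrix (Fin m) (Fin n) ℝ) (π : Equiv.Perm (Fin n)) (i : ℕ) :
    sv (permCols A π) i = sv A i := by
  refine le_antisymm
    (singularValues_le_of_comap _ _ (permVec π).toLinearEquiv.toLinearMap (by simp) (fun x => ?_) i)
    (singularValues_le_of_comap _ _ (permVec π).symm.toLinearEquiv.toLinearMap (by simp)
      (fun x => ?_) i)
  · simp [permCols_apply]
  · simp [permCols_apply]

/-- If a combination of the first `k` columns and the column `k + j` vanishes, so do the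
contributions of the latter to `R₂₂` and to the coordinates missing in the combination. -/
theorem IsPartialQR.mul_gamma_eq_zero {A R : Matrix (Fin m) (Fin n) ℝ} {Q : Matrix (Fin m) (Fin m) ℝ}
    (h : IsPartialQR k A Q R) (hm : k ≤ m) (hn : k ≤ n) (hdet : (R11 k hm hn R).det ≠ 0)
    {y : EuclideanSpace ℝ (Fin n)} {j : Fin (n - k)} {t : ℝ}
    (hy : tailLin k y = EuclideanSpace.single j t) (hA : A.toEuclideanLin y = 0) :
    t * gamma (R22 k R) j = 0 ∧
      ∀ i, y (Fin.castLE hn i) = 0 → t * ((R11 k hm hn R)⁻¹ * R12 k hm R) i j = 0 := by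
  have h1 := (h.isBlockTriangular hm hn hdet).norm_sq_apply y
  rw [hA, hy, norm_zero, norm_toEuclideanLin_single] at h1
  constructor
  · have : (|t| * gamma (R22 k R) j) ^ 2 = 0 := by
      refine le_antisymm ?_ (sq_nonneg _)
      nlinarith [sq_nonneg ‖(R11 k hm hn R).toEuclideanLin (headLin hn y +
        ((R11 k hm hn R)⁻¹ * R12 k hm R).toEuclideanLin (EuclideanSpace.single j t))‖]
    simpa using this
  · intro i hi
    set z := headLin hn y +
      ((R11 k hm hn R)⁻¹ * R12 k hm R).toEuclideanLin (EuclideanSpace.single j t) with hz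
    have h2 : ‖(R11 k hm hn R).toEuclideanLin z‖ ^ 2 = 0 := by
      refine le_antisymm ?_ (sq_nonneg _)
      nlinarith [sq_nonneg (|t| * gamma (R22 k R) j)]
    have h3 := abs_apply_le_omega hdet z i
    rw [pow_eq_zero_iff two_ne_zero] at h2
    rw [h2, mul_zero] at h3
    have h4 : z i = 0 := abs_eq_zero.1 (le_antisymm h3 (abs_nonneg _))
    rw [hz, PiLp.add_apply, headLin_apply, hi, zero_add] at h4
    rw [← h4]
    simp [Matrix.toLpLin_apply, -Matrix.toLpLin_mul_same]

/-- A relation among the new leading columns involves old leading columns other than `i`, and column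
`k + j`. The nonzero entry or norm kills the coefficient of the latter, and the old independence
does the rest. -/
theorem IsPartialQR.leadIndep_interchange {A R : Matrix (Fin m) (Fin n) ℝ}
    {Q : Matrix (Fin m) (Fin m) ℝ} (h : IsPartialQR k A Q R) (hm : k ≤ m) (hn : k ≤ n)
    (hA : LeadIndep A k) {i : Fin k} {j : Fin (n - k)}
    (hij : ((R11 k hm hn R)⁻¹ * R12 k hm R) i j ≠ 0 ∨ gamma (R22 k R) j ≠ 0) :
    LeadIndep (permCols A (Equiv.swap (Fin.castLE hn i) (tailIdx j))) k := by
  intro x hx hAx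
  rw [permCols_apply] at hAx
  set σ := Equiv.swap (Fin.castLE hn i) (tailIdx j) with hσ
  set y := permVec σ x with hy
  have hty : tailLin k y = EuclideanSpace.single j (y (tailIdx j)) := by
    ext l
    by_cases hl : l = j
    · subst hl; simp
    · have : σ (tailIdx l) = tailIdx l := by
        refine Equiv.swap_apply_of_ne_of_ne ?_ ?_
        · simp [Fin.ext_iff, tailIdx]; omega
        · simpa [Fin.ext_iff, tailIdx] using hl
      rw [tailLin_apply, hy, permVec_apply, hσ, Equiv.symm_swap, ← hσ, this,
        hx _ (by simp [tailIdx])]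
      simp [hl]
  obtain ⟨h1, h2⟩ := h.mul_gamma_eq_zero hm hn (h.det_ne_zero hm hn hA) hty hAx
  have h3 := h2 i (by
    rw [hy, permVec_apply, hσ, Equiv.symm_swap, Equiv.swap_apply_left]
    exact hx _ (by simp [tailIdx]))
  have ht : y (tailIdx j) = 0 := by
    rcases hij with hij | hij
    · exact (mul_eq_zero.1 h3).resolve_right hij
    · exact (mul_eq_zero.1 h1).resolve_right hij
  rw [ht] at hty
  have hy0 : y = 0 := hA y (tailLin_eq_zero.1 (hty.trans (by ext; simp))) hAx
  exact (permVec σ).map_eq_zero_iff.1 hy0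

theorem IsPartialQR.leadIndep_grow {A R : Matrix (Fin m) (Fin n) ℝ}
    {Q : Matrix (Fin m) (Fin m) ℝ} (h : IsPartialQR k A Q R) (hm : k ≤ m) (hn : k < n)
    (hA : LeadIndep A k) {j : Fin (n - k)} (hj : gamma (R22 k R) j ≠ 0) :
    LeadIndep (permCols A (Equiv.swap ⟨k, hn⟩ (tailIdx j))) (k + 1) := by
  intro x hx hAx
  rw [permCols_apply] at hAx
  set σ := Equiv.swap (⟨k, hn⟩ : Fin n) (tailIdx j) with hσ
  set y := permVec σ x with hy
  have hty : tailLin k y = EuclideanSpace.single j (y (tailIdx j)) := by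
    ext l
    by_cases hl : l = j
    · subst hl; simp
    · have h0 : x (σ (tailIdx l)) = 0 := by
        have hl' : (l : ℕ) ≠ j := fun h => hl (Fin.ext h)
        -- Tail position `0` is column `k`, itself moved by the swap. Its coordinate comes from `k +
        -- j`, beyond the new leading block because `j ≠ 0` here.
        by_cases hl0 : (l : ℕ) = 0
        · have e : (tailIdx l : Fin n) = ⟨k, hn⟩ := by simp [tailIdx, hl0]
          rw [e, hσ, Equiv.swap_apply_left]
          exact hx _ (by simp [tailIdx]; omega)
        · rw [hσ, Equiv.swap_apply_of_ne_of_ne]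
          · exact hx _ (by simp [tailIdx]; omega)
          · simp [Fin.ext_iff, tailIdx]; omega
          · simpa [Fin.ext_iff, tailIdx] using hl'
      rw [tailLin_apply, hy, permVec_apply, hσ, Equiv.symm_swap, ← hσ, h0]
      simp [hl]
  obtain ⟨h1, -⟩ := h.mul_gamma_eq_zero hm hn.le (h.det_ne_zero hm hn.le hA) hty hAx
  rw [(mul_eq_zero.1 h1).resolve_right hj] at hty
  have hy0 : y = 0 := hA y (tailLin_eq_zero.1 (hty.trans (by ext; simp))) hAx
  exact (permVec σ).map_eq_zero_iff.1 hy0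

theorem gamma_nonneg {p q : ℕ} (B : Matrix (Fin p) (Fin q) ℝ) (j : Fin q) : 0 ≤ gamma B j :=
  norm_nonneg _

theorem omega_nonneg (A : Matrix (Fin k) (Fin k) ℝ) (i : Fin k) : 0 ≤ omega A i :=
  norm_nonneg _

/-- If `R₂₂` vanished, `σ_{k+1}(A) ≤ σ_1(R₂₂)` would be zero; `sv A k` is `σ_{k+1}(A)`. -/
theorem IsPartialQR.exists_gamma_ne_zero {A R : Matrix (Fin m) (Fin n) ℝ}
    {Q : Matrix (Fin m) (Fin m) ℝ} (h : IsPartialQR k A Q R) (hm : k ≤ m) (hn : k ≤ n)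
    (hA : LeadIndep A k) (hk : sv A k ≠ 0) : ∃ j, gamma (R22 k R) j ≠ 0 := by
  by_contra! h0
  have h1 : R22 k R = 0 := by
    ext l j
    have := h0 j
    rw [gamma, norm_eq_zero] at this
    simpa using congrArg (fun y => y l) this
  have h2 := (h.isBlockTriangular hm hn (h.det_ne_zero hm hn hA)).singularValues_add_le 0
  rw [h1] at h2
  simp only [map_zero, LinearMap.singularValues_zero, Finsupp.zero_apply, zero_add,
    finrank_euclideanSpace, Fintype.card_fin] at h2
  exact hk (le_antisymm h2 (LinearMap.singularValues_nonneg _ _))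

/-- An interchange needs an entry or product above `f/√2 > 0`, so it is never degenerate. For
growth, `hs` covers both stopping rules: either the rank is not exhausted, or the largest column
norm is positive. -/
theorem Reach.leadIndep {A : Matrix (Fin d) (Fin n) ℝ} {f : ℝ} (hf : 0 < f) {s : StopRule}
    (hs : ∀ k g, s.Continue k g → sv A k ≠ 0 ∨ 0 < g) {π : Equiv.Perm (Fin n)}
    (h : Reach A f s k π) : LeadIndep (permCols A π) k := by
  induction h with
  | start =>
    intro x hx _
    ext b
    exact hx b (Nat.zero_le _)
  | @grow k π hd hn Q R j _ qr _ continues argmax ih =>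
    refine qr.leadIndep_grow hd.le hn ih fun hj => ?_
    rcases hs _ _ continues with h | h
    · obtain ⟨l, hl⟩ := qr.exists_gamma_ne_zero hd.le hn.le ih (by rwa [singularValues_permCols])
      exact hl (le_antisymm ((argmax l).trans hj.le) (gamma_nonneg _ _))
    · have : Nonempty (Fin (n - k)) := ⟨j⟩
      linarith [ciSup_le argmax]
  | @interchange k π hd hn Q R i j _ qr large ih =>
    refine qr.leadIndep_interchange hd hn ih ?_
    have hf2 : 0 < f / √2 := by positivity
    refine large.imp (fun h h0 => ?_) fun h h0 => ?_
    · rw [h0, abs_zero] at h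
      linarith
    · rw [h0, mul_zero] at h
      linarith

/-- Each of the two squares is at most `f²/2`, which explains the threshold `f/√2`. -/
theorem sq_add_sq_le_of_rhoHat_le {R : Matrix (Fin d) (Fin n) ℝ} {f : ℝ}
    {hd : k ≤ d} {hn : k ≤ n} (h : rhoHat k hd hn R ≤ f / √2) (i : Fin k) (j : Fin (n - k)) :
    (((R11 k hd hn R)⁻¹ * R12 k hd R) i j) ^ 2 +
      omega (R11 k hd hn R) i ^ 2 * gamma (R22 k R) j ^ 2 ≤ f ^ 2 := by
  have h1 := (le_ciSup (f := fun p : Fin k × Fin (n - k) =>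
    |((R11 k hd hn R)⁻¹ * R12 k hd R) p.1 p.2|) (Set.finite_range _).bddAbove (i, j)).trans
    ((le_max_left _ _).trans h)
  have h2 := (le_ciSup (f := fun p : Fin k × Fin (n - k) =>
    omega (R11 k hd hn R) p.1 * gamma (R22 k R) p.2) (Set.finite_range _).bddAbove (i, j)).trans
    ((le_max_right _ _).trans h)
  have h3 : (f / √2) ^ 2 = f ^ 2 / 2 := by rw [div_pow, Real.sq_sqrt (by norm_num)]
  have h4 := pow_le_pow_left₀ (abs_nonneg _) h1 2
  have h5 := pow_le_pow_left₀ (mul_nonneg (omega_nonneg _ _) (gamma_nonneg _ _)) h2 2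
  rw [h3] at h4 h5
  simp only [sq_abs, mul_pow] at h4 h5
  linarith

theorem sq_add_sq_le_of_rho_le {R : Matrix (Fin d) (Fin n) ℝ} {f : ℝ} (hf : 0 < f)
    {hd : k ≤ d} {hn : k ≤ n} (h : rho k hd hn R ≤ f) (i : Fin k) (j : Fin (n - k)) :
    (((R11 k hd hn R)⁻¹ * R12 k hd R) i j) ^ 2 +
      omega (R11 k hd hn R) i ^ 2 * gamma (R22 k R) j ^ 2 ≤ f ^ 2 := by
  have h1 := (le_ciSup (f := fun p : Fin k × Fin (n - k) =>
    √((((R11 k hd hn R)⁻¹ * R12 k hd R) p.1 p.2) ^ 2 +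
      omega (R11 k hd hn R) p.1 ^ 2 * gamma (R22 k R) p.2 ^ 2))
    (Set.finite_range _).bddAbove (i, j)).trans h
  exact (Real.sqrt_le_left hf.le).1 h1

theorem IsStrongRRQRPerm.exists_isPartialQR {A : Matrix (Fin d) (Fin n) ℝ} {f : ℝ} (hf : 0 < f)
    {π : Equiv.Perm (Fin n)} (hk : ∀ i < k, sv A i ≠ 0) (h : IsStrongRRQRPerm A f k π) :
    ∃ (hd : k ≤ d) (hn : k ≤ n) (Q : Matrix (Fin d) (Fin d) ℝ) (R : Matrix (Fin d) (Fin n) ℝ),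
      IsPartialQR k (permCols A π) Q R ∧ (R11 k hd hn R).det ≠ 0 ∧
      ∀ i j, (((R11 k hd hn R)⁻¹ * R12 k hd R) i j) ^ 2 +
        omega (R11 k hd hn R) i ^ 2 * gamma (R22 k R) j ^ 2 ≤ f ^ 2 := by
  rcases h with ⟨hr, hd, hn, Q, R, qr, hrho, -⟩ | ⟨τ, hτ, hr, hd, hn, Q, R, qr, hrho, -⟩ |
    ⟨hd, hn, Q, R, qr, hdet, hrho⟩
  · have := hr.leadIndep hf fun l g hl => .inl (hk l (by simpa [StopRule.Continue] using hl))
    exact ⟨hd, hn, Q, R, qr, qr.det_ne_zero hd hn this, sq_add_sq_le_of_rhoHat_le hrho⟩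
  · have := hr.leadIndep hf fun l g hl => .inr (hτ.trans_le (by simpa [StopRule.Continue] using hl))
    exact ⟨hd, hn, Q, R, qr, qr.det_ne_zero hd hn this, sq_add_sq_le_of_rhoHat_le hrho⟩
  · exact ⟨hd, hn, Q, R, qr, hdet, sq_add_sq_le_of_rho_le hf hrho⟩

/-- The quantity bounding `ρ` grows at most by the distortion of the column space. -/
theorem IsPartialQR.mul_sq_add_sq_le {A R : Matrix (Fin m) (Fin n) ℝ}
    {Q : Matrix (Fin m) (Fin m) ℝ} {A' R' : Matrix (Fin d) (Fin n) ℝ}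
    {Q' : Matrix (Fin d) (Fin d) ℝ} (h : IsPartialQR k A Q R) (h' : IsPartialQR k A' Q' R')
    (hm : k ≤ m) (hd : k ≤ d) (hn : k ≤ n) (hdet : (R11 k hm hn R).det ≠ 0)
    (hdet' : (R11 k hd hn R').det ≠ 0) {a b : ℝ}
    (ha : ∀ x, a * ‖A.toEuclideanLin x‖ ^ 2 ≤ ‖A'.toEuclideanLin x‖ ^ 2)
    (hb : ∀ x, ‖A'.toEuclideanLin x‖ ^ 2 ≤ b * ‖A.toEuclideanLin x‖ ^ 2) (ha0 : 0 < a)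
    (i : Fin k) (j : Fin (n - k)) :
    0 < b ∧ a * ((((R11 k hm hn R)⁻¹ * R12 k hm R) i j) ^ 2 +
        omega (R11 k hm hn R) i ^ 2 * gamma (R22 k R) j ^ 2) ≤
      b * ((((R11 k hd hn R')⁻¹ * R12 k hd R') i j) ^ 2 +
        omega (R11 k hd hn R') i ^ 2 * gamma (R22 k R') j ^ 2) := by
  have hT := h.isBlockTriangular hm hn hdet
  have hT' := h'.isBlockTriangular hd hn hdet'
  set N := (R11 k hm hn R)⁻¹ * R12 k hm R with hN
  set N' := (R11 k hd hn R')⁻¹ * R12 k hd R' with hN'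
  set ω := omega (R11 k hm hn R) i
  set ω' := omega (R11 k hd hn R') i
  have hω : 0 < ω := omega_pos hdet i
  have hω' : 0 < ω' := omega_pos hdet' i
  -- Test the minimizer for the unsketched `1/ω` in the sketched problem.
  have hωω : ω ^ 2 ≤ b * ω' ^ 2 := by
    obtain ⟨y, hy, hy1⟩ := exists_omega_mul_norm_eq hdet i
    have e := hT.norm_sq_apply (glue hn y 0)
    have e' := hT'.norm_sq_apply (glue hn y 0)
    rw [headLin_glue, tailLin_glue, map_zero, map_zero, add_zero, norm_zero] at e e'
    have h1 := hb (glue hn y 0)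
    have h2 := abs_apply_le_omega hdet' y i
    rw [hy, abs_one] at h2
    have h3 := one_le_pow₀ h2 (n := 2)
    have h4 : ω ^ 2 * ‖(R11 k hm hn R).toEuclideanLin y‖ ^ 2 = 1 := by
      rw [← mul_pow, hy1, one_pow]
    rw [e, e'] at h1
    rw [mul_pow] at h3
    have h5 := mul_le_mul_of_nonneg_left h1 (by positivity : 0 ≤ ω ^ 2 * ω' ^ 2)
    have h6 := mul_le_mul_of_nonneg_left h3 (sq_nonneg ω)
    nlinarith
  -- Positivity of `b` is derived, not assumed; with `b = 1 + ε` it later makes the square root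
  -- defining `f̃` genuine.
  have hb0 : 0 < b := by
    by_contra! hb0
    nlinarith [mul_nonneg_of_nonpos_of_nonpos hb0 (neg_nonpos.2 (sq_nonneg ω')), pow_pos hω 2]
  refine ⟨hb0, ?_⟩
  have hsingle : ∀ {B : Matrix (Fin k) (Fin (n - k)) ℝ},
      B.toEuclideanLin (EuclideanSpace.single j 1) i = B i j := fun {B} => by
    simp [Matrix.toLpLin_apply]
  obtain ⟨z, hz, hz1⟩ := exists_omega_mul_norm_eq hdet' i
  -- The sketched minimizer of `‖A'x‖` among `x` with tail `e_j` and vanishing coordinate `i`: the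
  -- multiple `N'_ij` of `z` cancels coordinate `i` of `-N' e_j`. For the unsketched matrix it is
  -- merely a competitor.
  set x := glue hn (N' i j • z - N'.toEuclideanLin (EuclideanSpace.single j 1))
    (EuclideanSpace.single j 1) with hx
  have hxh : headLin hn x i = 0 := by
    rw [hx, headLin_glue, PiLp.sub_apply, PiLp.smul_apply, hz, hsingle]
    simp
  have e := hT.norm_sq_apply x
  have e' := hT'.norm_sq_apply x
  rw [hx, headLin_glue, tailLin_glue, ← hx, sub_add_cancel, map_smul, norm_smul,
    norm_toEuclideanLin_single, mul_pow, Real.norm_eq_abs, sq_abs, abs_one, one_mul] at e'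
  rw [show tailLin k x = EuclideanSpace.single j 1 by rw [hx, tailLin_glue],
    norm_toEuclideanLin_single, abs_one, one_mul] at e
  have h1 : N i j ^ 2 + ω ^ 2 * gamma (R22 k R) j ^ 2 ≤ ω ^ 2 * ‖A.toEuclideanLin x‖ ^ 2 := by
    have := abs_apply_le_omega hdet
      (headLin hn x + N.toEuclideanLin (EuclideanSpace.single j 1)) i
    rw [PiLp.add_apply, hxh, zero_add, hsingle] at this
    have := pow_le_pow_left₀ (abs_nonneg _) this 2
    rw [sq_abs, mul_pow] at this
    rw [e]
    linarith
  have h2 : ω' ^ 2 * ‖A'.toEuclideanLin x‖ ^ 2 =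
      N' i j ^ 2 + ω' ^ 2 * gamma (R22 k R') j ^ 2 := by
    have : ω' ^ 2 * ‖(R11 k hd hn R').toEuclideanLin z‖ ^ 2 = 1 := by
      rw [← mul_pow, hz1, one_pow]
    rw [e']
    linear_combination N' i j ^ 2 * this
  calc a * (N i j ^ 2 + ω ^ 2 * gamma (R22 k R) j ^ 2)
      ≤ a * (ω ^ 2 * ‖A.toEuclideanLin x‖ ^ 2) := by gcongr
    _ = ω ^ 2 * (a * ‖A.toEuclideanLin x‖ ^ 2) := by ring
    _ ≤ ω ^ 2 * ‖A'.toEuclideanLin x‖ ^ 2 := by gcongr; exact ha x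
    _ ≤ b * ω' ^ 2 * ‖A'.toEuclideanLin x‖ ^ 2 := by gcongr
    _ = _ := by rw [mul_assoc, h2]

end Exchange

/-! ### Consequences of the embedding, and Frobenius-norm form of the block bounds. -/

section Sketch

variable {m n d k : ℕ}

theorem IsEmbedding.norm_sq_bounds {ε : ℝ} {Ω : Matrix (Fin d) (Fin m) ℝ}
    {M : Matrix (Fin m) (Fin n) ℝ} (h : IsEmbedding ε Ω (range M))
    (x : EuclideanSpace ℝ (Fin n)) :
    (1 - ε) * ‖M.toEuclideanLin x‖ ^ 2 ≤ ‖(Ω * M).toEuclideanLin x‖ ^ 2 ∧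
      ‖(Ω * M).toEuclideanLin x‖ ^ 2 ≤ (1 + ε) * ‖M.toEuclideanLin x‖ ^ 2 := by
  have h1 := h _ (LinearMap.mem_range_self _ x) _ (LinearMap.mem_range_self _ x)
  rw [real_inner_self_eq_norm_sq, real_inner_self_eq_norm_sq, ← toEuclideanLin_mul_apply] at h1
  constructor <;> nlinarith [abs_le.1 h1]

theorem finrank_range_toEuclideanLin (M : Matrix (Fin m) (Fin n) ℝ) :
    finrank ℝ (LinearMap.range M.toEuclideanLin) = M.rank := by
  rw [Matrix.toEuclideanLin, Matrix.toLpLin_eq_toLin]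
  exact (Matrix.rank_eq_finrank_range_toLin M _ _).symm

theorem sv_ne_zero_iff (M : Matrix (Fin m) (Fin n) ℝ) (i : ℕ) : sv M i ≠ 0 ↔ i < M.rank := by
  rw [← finrank_range_toEuclideanLin, ← LinearMap.singularValues_pos_iff_lt_finrank_range,
    LinearMap.singularValues_pos_iff_ne_zero]
  rfl

/-- Since `1 - ε > 0`, the lower norm bound makes `Ω` injective on the range of `M`, so the kernels
of `Ω * M` and `M` agree. -/
theorem IsEmbedding.rank_mul {ε : ℝ} (hε : ε < 1) {Ω : Matrix (Fin d) (Fin m) ℝ}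
    {M : Matrix (Fin m) (Fin n) ℝ} (h : IsEmbedding ε Ω (range M)) : (Ω * M).rank = M.rank := by
  have hker : LinearMap.ker (Ω * M).toEuclideanLin = LinearMap.ker M.toEuclideanLin := by
    ext x
    rw [LinearMap.mem_ker, LinearMap.mem_ker]
    constructor
    · intro hx
      have h1 := (h.norm_sq_bounds x).1
      rw [hx, norm_zero] at h1
      rw [← norm_eq_zero]
      by_contra h0
      nlinarith [mul_pos (sub_pos.2 hε) (pow_pos ((norm_nonneg _).lt_of_ne' h0) 2)]
    · intro hx
      rw [toEuclideanLin_mul_apply, hx, map_zero]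
  have h1 := LinearMap.finrank_range_add_finrank_ker (Ω * M).toEuclideanLin
  have h2 := LinearMap.finrank_range_add_finrank_ker M.toEuclideanLin
  rw [← finrank_range_toEuclideanLin, ← finrank_range_toEuclideanLin]
  rw [hker] at h1
  omega

theorem permCols_mul (Ω : Matrix (Fin d) (Fin m) ℝ) (M : Matrix (Fin m) (Fin n) ℝ)
    (π : Equiv.Perm (Fin n)) : permCols (Ω * M) π = Ω * permCols M π := rfl

theorem range_permCols_le (M : Matrix (Fin m) (Fin n) ℝ) (π : Equiv.Perm (Fin n)) :
    range (permCols M π) ≤ range M := by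
  rintro _ ⟨x, rfl⟩
  exact ⟨permVec π x, (permCols_apply M π x).symm⟩

/-- The Gu–Eisenstat bounds for the singular values of the diagonal blocks. -/
theorem IsPartialQR.sv_bounds {M R : Matrix (Fin m) (Fin n) ℝ} {Q : Matrix (Fin m) (Fin m) ℝ}
    (h : IsPartialQR k M Q R) (hm : k ≤ m) (hn : k ≤ n)
    (hdet : (R11 k hm hn R).det ≠ 0) {g : ℝ}
    (hg : ∀ i j, (((R11 k hm hn R)⁻¹ * R12 k hm R) i j) ^ 2 +
        omega (R11 k hm hn R) i ^ 2 * gamma (R22 k R) j ^ 2 ≤ g) :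
    (∀ i : Fin k, 0 < sv (R11 k hm hn R) i ∧ sv (R11 k hm hn R) i ≤ sv M i ∧
      sv M i ≤ √(1 + g * k * ((n : ℝ) - k)) * sv (R11 k hm hn R) i) ∧
    ∀ j : Fin (n - k), sv M (j + k) ≤ sv (R22 k R) j ∧
      sv (R22 k R) j ≤ √(1 + g * k * ((n : ℝ) - k)) * sv M (j + k) := by
  have hT := h.isBlockTriangular hm hn hdet
  set A := R11 k hm hn R
  set N := A⁻¹ * R12 k hm R
  set B := R22 k R
  have hA : ∀ x, ‖x‖ ≤ √(∑ i, ∑ j, A⁻¹ i j ^ 2) * ‖A.toEuclideanLin x‖ := fun x => by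
    have := norm_toEuclideanLin_le A⁻¹ (A.toEuclideanLin x)
    rwa [toEuclideanLin_inv_apply hdet] at this
  -- With Frobenius norms as `ν`, `w`, `β`, the left side is exactly the sum over all `k(n - k)`
  -- pairs of the quantities bounded by `g`.
  have hs : √(∑ i, ∑ j, N i j ^ 2) ^ 2 +
      √(∑ i, ∑ j, A⁻¹ i j ^ 2) ^ 2 * √(∑ i, ∑ j, B i j ^ 2) ^ 2 ≤ g * k * ((n : ℝ) - k) := by
    rw [Real.sq_sqrt (by positivity), Real.sq_sqrt (by positivity), Real.sq_sqrt (by positivity),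
      ← sum_omega_sq A, ← sum_gamma_sq B, Finset.sum_mul_sum, ← Finset.sum_add_distrib]
    simp_rw [← Finset.sum_add_distrib]
    refine (Finset.sum_le_sum fun i _ => Finset.sum_le_sum fun j _ => hg i j).trans ?_
    simp [Nat.cast_sub hn]
    linarith
  have hfk : finrank ℝ (EuclideanSpace ℝ (Fin k)) = k := by simp
  have hfnk : finrank ℝ (EuclideanSpace ℝ (Fin (n - k))) = n - k := by simp
  refine ⟨fun i => ⟨?_, ?_, ?_⟩, fun j => ⟨?_, ?_⟩⟩
  · refine (LinearMap.injective_iff_forall_lt_finrank_singularValues_pos _).1 ?_ _ (by simp)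
    exact Function.LeftInverse.injective (toEuclideanLin_inv_apply hdet)
  -- Padding by zeros: `R₁₁` is, up to isometry, the restriction of `M` to the first `k`
  -- coordinates.
  · let J : EuclideanSpace ℝ (Fin k) →ₗ[ℝ] EuclideanSpace ℝ (Fin n) :=
      { toFun := fun x => glue hn x 0
        map_add' := fun x y => eq_of_headLin_of_tailLin hn (by simp) (by simp)
        map_smul' := fun c x => eq_of_headLin_of_tailLin hn (by simp) (by simp) }
    have hJ : ∀ x, J x = glue hn x 0 := fun _ => rfl
    refine singularValues_le_of_comap _ _ J (fun x => ?_) (fun x => ?_) i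
    · rw [← sq_eq_sq₀ (norm_nonneg _) (norm_nonneg _), norm_sq_split hn]
      simp [hJ]
    · rw [← sq_eq_sq₀ (norm_nonneg _) (norm_nonneg _), hT.norm_sq_apply]
      simp [hJ]
  · exact hT.singularValues_le_mul hA (norm_toEuclideanLin_le N) (norm_toEuclideanLin_le B) hs
      (by simp)
  · have := hT.singularValues_add_le j
    rwa [hfk] at this
  · have := hT.singularValues_le_mul_add hA (norm_toEuclideanLin_le N) (Real.sqrt_nonneg _)
      (norm_toEuclideanLin_le B) hs (j := j) (by simp)
    rwa [hfk] at this

end Sketch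

end SRRQR

end

theorem theorem4p1 {m n d : ℕ} (M : Matrix (Fin m) (Fin n) ℝ) (Ω : Matrix (Fin d) (Fin m) ℝ)
    (ε f : ℝ) (hε : ε < 1) (hf : 0 < f)
    (hΩ : SRRQR.IsEmbedding ε Ω (SRRQR.range M))
    (k : ℕ) (hkm : k ≤ m) (hkn : k ≤ n) (hk : k ≤ M.rank)
    (π : Equiv.Perm (Fin n)) (hπ : SRRQR.IsStrongRRQRPerm (Ω * M) f k π)
    (Q : Matrix (Fin m) (Fin m) ℝ) (R : Matrix (Fin m) (Fin n) ℝ)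
    (hQR : SRRQR.IsPartialQR k (SRRQR.permCols M π) Q R)
    (f' q : ℝ) (hf' : f' = √((1 + ε) / (1 - ε)) * f)
    (hq : q = √(1 + f' ^ 2 * (k : ℝ) * ((n : ℝ) - (k : ℝ)))) :
    (SRRQR.R11 k hkm hkn R).det ≠ 0 ∧
    (∀ i : Fin k, 0 < SRRQR.sv (SRRQR.R11 k hkm hkn R) i ∧
      1 ≤ SRRQR.sv M i / SRRQR.sv (SRRQR.R11 k hkm hkn R) i ∧
      SRRQR.sv M i / SRRQR.sv (SRRQR.R11 k hkm hkn R) i ≤ q) ∧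
    (∀ j : Fin (n - k),
      (SRRQR.sv M (j + k) ≠ 0 →
        1 ≤ SRRQR.sv (SRRQR.R22 k R) j / SRRQR.sv M (j + k) ∧
        SRRQR.sv (SRRQR.R22 k R) j / SRRQR.sv M (j + k) ≤ q) ∧
      (SRRQR.sv M (j + k) = 0 → SRRQR.sv (SRRQR.R22 k R) j = 0)) ∧
    (∀ (i : Fin k) (j : Fin (n - k)),
      |((SRRQR.R11 k hkm hkn R)⁻¹ * SRRQR.R12 k hkm R) i j| ≤ f') := by

  obtain ⟨hkd, _, Q', R', hQR', hdet', hf2⟩ := hπ.exists_isPartialQR hf fun i hi => by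
    rw [SRRQR.sv_ne_zero_iff, hΩ.rank_mul hε]
    exact hi.trans_le hk
  rw [SRRQR.permCols_mul] at hQR'
  have hΩπ : SRRQR.IsEmbedding ε Ω (SRRQR.range (SRRQR.permCols M π)) := fun x hx y hy =>
    hΩ x (SRRQR.range_permCols_le M π hx) y (SRRQR.range_permCols_le M π hy)
  have hdet : (SRRQR.R11 k hkm hkn R).det ≠ 0 := by
    -- A relation among the leading columns of `MΠ` persists after applying `Ω`, where it is
    -- excluded.
    refine hQR.det_ne_zero hkm hkn fun x hx hMx => ?_
    refine hQR'.leadIndep hkd hkn hdet' x hx ?_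
    rw [SRRQR.toEuclideanLin_mul_apply, hMx, map_zero]
  have hε' : 0 < 1 - ε := sub_pos.2 hε
  have hρ : ∀ i j, (((SRRQR.R11 k hkm hkn R)⁻¹ * SRRQR.R12 k hkm R) i j) ^ 2 +
      SRRQR.omega (SRRQR.R11 k hkm hkn R) i ^ 2 * SRRQR.gamma (SRRQR.R22 k R) j ^ 2 ≤
        f' ^ 2 := by
    intro i j
    obtain ⟨hb, h⟩ := hQR.mul_sq_add_sq_le hQR' hkm hkd hkn hdet hdet'
      (fun x => (hΩπ.norm_sq_bounds x).1) (fun x => (hΩπ.norm_sq_bounds x).2) hε' i j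
    have h2 := h.trans (mul_le_mul_of_nonneg_left (hf2 i j) hb.le)
    rw [hf', mul_pow, Real.sq_sqrt (by positivity), div_mul_eq_mul_div, le_div_iff₀' hε']
    exact h2
  obtain ⟨h1, h2⟩ := hQR.sv_bounds hkm hkn hdet hρ
  simp only [SRRQR.singularValues_permCols, ← hq] at h1 h2
  refine ⟨hdet, fun i => ?_, fun j => ⟨fun hj => ?_, fun hj => ?_⟩, fun i j => ?_⟩
  · obtain ⟨hpos, hle, hge⟩ := h1 i
    exact ⟨hpos, (one_le_div hpos).2 hle, (div_le_iff₀ hpos).2 hge⟩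
  · have hpos : 0 < SRRQR.sv M (j + k) := (LinearMap.singularValues_pos_iff_ne_zero _ _).2 hj
    exact ⟨(one_le_div hpos).2 (h2 j).1, (div_le_iff₀ hpos).2 (h2 j).2⟩
  · have := h2 j
    rw [hj, mul_zero] at this
    exact le_antisymm this.2 this.1
  · have hf0 : 0 ≤ f' := by rw [hf']; positivity
    refine abs_le_of_sq_le_sq (le_trans ?_ (hρ i j)) hf0
    exact le_add_of_nonneg_right (by positivity)
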